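/- Let $n,m,k,l$ be integers with $1\le k\le n$ and $1\le l\le m$, and let $$\Theta^{\mathrm{asym}}_{kl}=\bigl\{\theta\in[0,1]^{n\times m}:\ \theta_{ij}=Q_{z_1(i)z_2(j)}\ \text{for all } i,j,\ \text{for some } Q\in[0,1]^{k\times l},\ z_1:[n]\to[k],\ z_2:[m]\to[l]\bigr\},$$ where $[d]=\{1,\dots,d\}$. One observes a random matrix $A\in\{0,1\}^{n\times m}$ with independent entries $A_{ij}\sim\mathrm{Bernoulli}(\theta_{ij})$, and $\mathbb{E}_\theta$ denotes expectation under this law. For every constant $C_0>0$ there is a constant $C>0$, depending only on $C_0$, such that for all integers $1\le k\le n$ and $1\le l\le m$ with $C_0^{-1}\log l\le\log k\le C_0\log l$ (that is, $\log k\asymp\log l$ with constant $C_0$), $$C^{-1}\Bigl(\frac{kl}{nm}+\frac{\log k}{m}+\frac{\log l}{n}\Bigr)\ \le\ \inf_{\hat\theta}\ \sup_{\theta\in\Theta^{\mathrm{asym}}_{kl}}\mathbb{E}_\theta\Bigl\{\frac{1}{nm}\sum_{i=1}^n\sum_{j=1}^m(\hat\theta_{ij}-\theta_{ij})^2\Bigr\}\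 \le\ C\Bigl(\frac{kl}{nm}+\frac{\log k}{m}+\frac{\log l}{n}\Bigr),$$ where the infimum is over all estimators $\hat\theta=\hat\theta(A)\in\mathbb{R}^{n\times m}$ (which may depend on $n,m,k,l$). -/

import Mathlib

open MeasureTheory ProbabilityTheory
open scoped ENNReal unitInterval

noncomputable section

namespace Biclustering

/-- The asymmetric (biclustering) block model: the matrices `θ ∈ [0,1]^{n × m}` such that
`θ i j = Q a b` whenever `i ∈ z₁⁻¹(a)` and `j ∈ z₂⁻¹(b)`, for some `Q ∈ [0,1]^{k × l}` and some maps
`z₁ : [n] → [k]` and `z₂ : [m] → [l]` (not required to be surjective). -/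
def parameterSpace (n m k l : ℕ) : Set (Matrix (Fin n) (Fin m) I) :=
  {θ | ∃ (Q : Matrix (Fin k) (Fin l) I) (z₁ : Fin n → Fin k) (z₂ : Fin m → Fin l),
    ∀ i j, θ i j = Q (z₁ i) (z₂ j)}

/-- The observed binary `n × m` array; `true` stands for `1` and `false` for `0`. -/
abbrev Data (n m : ℕ) : Type := Fin n × Fin m → Bool

/-- The law of the data under `θ`: the entries `A (i, j)` are independent and
`A (i, j) ∼ Bernoulli(θ i j)`. -/
def dataLaw {n m : ℕ} (θ : Matrix (Fin n) (Fin m) I) : Measure (Data n m) :=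
  Measure.pi fun ij : Fin n × Fin m => bernoulliMeasure true false (θ ij.1 ij.2)

/-- An estimator of `θ`: an arbitrary real-matrix-valued function of the data. (The sample space is
finite and discrete, so that each such function is measurable.) -/
abbrev Estimator (n m : ℕ) : Type := Data n m → Matrix (Fin n) (Fin m) ℝ

/-- The normalized squared error loss `(1 / (n m)) ∑_{i, j} (T i j - θ i j) ^ 2`. -/
def loss {n m : ℕ} (T : Matrix (Fin n) (Fin m) ℝ) (θ : Matrix (Fin n) (Fin m) I) : ℝ :=
  1 / ((n : ℝ) * (m : ℝ)) * ∑ i, ∑ j, (T i j - (θ i j : ℝ)) ^ 2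

/-- The risk of the estimator `T` at `θ`: the expected loss, as a number in `[0, ∞]`. -/
def risk {n m : ℕ} (T : Estimator n m) (θ : Matrix (Fin n) (Fin m) I) : ℝ≥0∞ :=
  ∫⁻ A, ENNReal.ofReal (loss (T A) θ) ∂(dataLaw θ)

/-- The minimax risk over the biclustering block model: the infimum over all estimators of the
supremum over the parameter space of the risk. -/
def minimaxRisk (n m k l : ℕ) : ℝ≥0∞ :=
  ⨅ T : Estimator n m, ⨆ θ ∈ parameterSpace n m k l, risk T θ

/-- The rate `k l / (n m) + log k / m + log l / n`. -/
def rate (n m k l : ℕ) : ℝ :=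
  ((k : ℝ) * (l : ℝ)) / ((n : ℝ) * (m : ℝ)) + Real.log k / m + Real.log l / n

end Biclustering

end

namespace Biclustering

open Finset

/-! For the upper bound, take least squares over all pairs of labellings. If the fitted structure is
`h`, the error splits orthogonally into the bias of projecting `θ` onto block-constant arrays and
the projected noise. Minimality bounds the bias by a linear form in the noise plus the squared
projected noise (`least_squares_le`). Both have exponential moments controlled by Hoeffding's lemma
(`sum_weight_mul_exp_le`, `sum_weight_mul_exp_sq_le`). A union bound over the `k ^ n * l ^ m`
structures costs `n log k + m log l`, and the `k * l` projected directions cost a multiple of `k *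
l`; dividing by `n * m` gives the rate.

For the lower bound, entries equal `1/2 ± δ` and the array is cut into groups, each carrying an
unknown label. With the other labels fixed, a group is a multiple testing problem whose likelihood
ratios against fair coins have second moment `(1 + 4δ²) ^ N`, so a label cannot be found when `δ² N`
is a small multiple of the log of the number of labels. Averaging over labels adds up the errors of
the groups (`exists_labelling_lower_bound`). Groups equal to blocks with a sign each give `k l / (n
m)`. Groups equal to rows or columns, with Walsh functions as codewords, give the logarithmic terms
with `min k l` in place of `k` and `l`; comparability of `log k` and `log l` removes the minimum. -/

/-- The probability of the binary array `A` when its entries are independent with means `θ`. -/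
noncomputable def weight {P : Type*} [Fintype P] (θ : P → ℝ) (A : P → Bool) : ℝ :=
  ∏ p, if A p then θ p else 1 - θ p

/-- The centred entries of the binary array `A`. -/
noncomputable def noise {P : Type*} (θ : P → ℝ) (A : P → Bool) (p : P) : ℝ :=
  (if A p then 1 else 0) - θ p

/-! ### Exponential moments of Bernoulli noise -/

section Weight

variable {P : Type*} [Fintype P]

lemma sum_prod_bool [DecidableEq P] (f : P → Bool → ℝ) :
    ∑ A : P → Bool, ∏ p, f p (A p) = ∏ p, (f p true + f p false) := by
  have := Finset.prod_univ_sum (fun _ : P => (Finset.univ : Finset Bool)) f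
  rw [Fintype.piFinset_univ] at this
  rw [← this]
  simp only [Fintype.sum_bool]

lemma weight_nonneg {θ : P → ℝ} (h0 : ∀ p, 0 ≤ θ p) (h1 : ∀ p, θ p ≤ 1) (A : P → Bool) :
    0 ≤ weight θ A := by
  refine Finset.prod_nonneg fun p _ => ?_
  split_ifs
  · exact h0 p
  · linarith [h1 p]

lemma sum_weight [DecidableEq P] (θ : P → ℝ) : ∑ A, weight θ A = 1 := by
  have := sum_prod_bool (fun p (x : Bool) => if x then θ p else 1 - θ p)
  simpa [weight] using this

/-- Hoeffding's lemma: a variable in an interval of length one is sub-Gaussian with variance proxy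
1/4. -/
lemma bernoulli_mgf_le {t : ℝ} (h0 : 0 ≤ t) (h1 : t ≤ 1) (c : ℝ) :
    t * Real.exp (c * (1 - t)) + (1 - t) * Real.exp (c * (0 - t)) ≤ Real.exp (c ^ 2 / 8) := by
  let p : I := ⟨t, h0, h1⟩
  have hH := hasSubgaussianMGF_of_mem_Icc (μ := bernoulliMeasure (1 : ℝ) 0 p) (X := id)
    (a := 0) (b := 1) aemeasurable_id (by
      rw [bernoulliMeasure_def, ae_add_measure_iff]
      constructor <;> refine Measure.ae_smul_measure ?_ _ <;> simp [ae_dirac_eq])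
  have hm := hH.mgf_le c
  have e1 : ∫ x, id x ∂(bernoulliMeasure (1 : ℝ) 0 p) = t := by
    rw [integral_bernoulliMeasure]; simp [p]
  rw [e1] at hm
  simp only [mgf] at hm
  rw [integral_bernoulliMeasure] at hm
  simp only [p, id, smul_eq_mul] at hm
  refine hm.trans (le_of_eq ?_)
  congr 1
  norm_num
  ring

lemma sum_weight_mul_exp_le [DecidableEq P] {θ : P → ℝ} (h0 : ∀ p, 0 ≤ θ p)
    (h1 : ∀ p, θ p ≤ 1) (c : P → ℝ) :
    ∑ A, weight θ A * Real.exp (c ⬝ᵥ noise θ A) ≤ Real.exp (c ⬝ᵥ c / 8) := by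
  have h := sum_prod_bool (fun p (x : Bool) =>
    (if x then θ p else 1 - θ p) * Real.exp (c p * ((if x then 1 else 0) - θ p)))
  have e : ∀ A, weight θ A * Real.exp (c ⬝ᵥ noise θ A) = ∏ p, ((if A p then θ p else 1 - θ p) *
      Real.exp (c p * ((if A p then 1 else 0) - θ p))) := by
    intro A
    rw [Finset.prod_mul_distrib, ← Real.exp_sum]
    rfl
  simp_rw [e]
  rw [h]
  have e2 : Real.exp (c ⬝ᵥ c / 8) = ∏ p, Real.exp (c p ^ 2 / 8) := by
    rw [← Real.exp_sum]
    simp only [dotProduct, Finset.sum_div, pow_two]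
  rw [e2]
  refine Finset.prod_le_prod (fun p _ => ?_) (fun p _ => ?_)
  · have := h0 p
    have := h1 p
    have : 0 ≤ 1 - θ p := by linarith
    simp only [if_true, Bool.false_eq_true, if_false]
    positivity
  · simpa using bernoulli_mgf_le (h0 p) (h1 p) (c p)

lemma exp_neg_sq_add_eq (s x : ℝ) :
    Real.exp (-x ^ 2 + 2 * s * x) = Real.exp (s ^ 2) * Real.exp (-1 * (x - s) ^ 2) := by
  rw [← Real.exp_add]; ring_nf

lemma integrable_exp_neg_sq_add (s : ℝ) :
    Integrable fun x : ℝ => Real.exp (-x ^ 2 + 2 * s * x) := by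
  simp_rw [exp_neg_sq_add_eq]
  exact ((integrable_exp_neg_mul_sq one_pos).comp_sub_right s).const_mul _

lemma integral_exp_neg_sq_add (s : ℝ) :
    ∫ x : ℝ, Real.exp (-x ^ 2 + 2 * s * x) = √Real.pi * Real.exp (s ^ 2) := by
  simp_rw [exp_neg_sq_add_eq]
  rw [integral_const_mul, integral_sub_right_eq_self (fun x : ℝ => Real.exp (-1 * x ^ 2)) s,
    integral_gaussian]
  simp [mul_comm]

/-- Exponential moment of the squared projection of the noise on an orthogonal family. -/
lemma sum_weight_mul_exp_sq_le [DecidableEq P] {β : Type*} [DecidableEq β] {θ : P → ℝ}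
    (h0 : ∀ p, 0 ≤ θ p) (h1 : ∀ p, θ p ≤ 1) (u : β → P → ℝ)
    (hu : ∀ a b, a ≠ b → u a ⬝ᵥ u b = 0) (hu1 : ∀ b, u b ⬝ᵥ u b ≤ 1) (s : Finset β) :
    ∀ c : P → ℝ, (∀ b ∈ s, u b ⬝ᵥ c = 0) →
      ∑ A, weight θ A * Real.exp (∑ b ∈ s, (u b ⬝ᵥ noise θ A) ^ 2 + c ⬝ᵥ noise θ A) ≤
        √2 ^ s.card * Real.exp (c ⬝ᵥ c / 8) := by
  induction s using Finset.induction_on with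
  | empty =>
    intro c _
    simpa using sum_weight_mul_exp_le h0 h1 c
  | insert b s hb ih =>
    intro c hc
    have hw := weight_nonneg h0 h1
    have hπ : 0 < √Real.pi := Real.sqrt_pos.mpr Real.pi_pos
    -- Gaussian linearization: `√π exp(s²) = ∫ exp(-x² + 2sx) dx` turns one square into a linear
    -- term in the noise, which is absorbed into `c`. This is why the induction runs over all `c`
    -- orthogonal to the remaining vectors.
    set G : (P → Bool) → ℝ → ℝ := fun A x =>
      weight θ A * Real.exp (∑ b ∈ s, (u b ⬝ᵥ noise θ A) ^ 2 + c ⬝ᵥ noise θ A) *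
        Real.exp (-x ^ 2 + 2 * (u b ⬝ᵥ noise θ A) * x) with hG
    have hGi : ∀ A, Integrable (G A) := fun A => (integrable_exp_neg_sq_add _).const_mul _
    have e1 : √Real.pi * ∑ A, weight θ A *
        Real.exp (∑ b ∈ insert b s, (u b ⬝ᵥ noise θ A) ^ 2 + c ⬝ᵥ noise θ A) =
        ∫ x, ∑ A, G A x := by
      rw [integral_finsetSum _ fun A _ => hGi A, Finset.mul_sum]
      refine Finset.sum_congr rfl fun A _ => ?_
      simp only [hG]
      rw [integral_const_mul, integral_exp_neg_sq_add, Finset.sum_insert hb, add_assoc,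
        Real.exp_add]
      ring
    have e2 : ∀ x, ∑ A, G A x ≤
        √2 ^ s.card * Real.exp (c ⬝ᵥ c / 8) * Real.exp (-(1 / 2) * x ^ 2) := by
      intro x
      have horth : ∀ a ∈ s, u a ⬝ᵥ (c + (2 * x) • u b) = 0 := by
        intro a ha
        rw [dotProduct_add, dotProduct_smul, hc a (Finset.mem_insert_of_mem ha),
          hu a b (by rintro rfl; exact hb ha)]
        simp
      have key := ih (c + (2 * x) • u b) horth
      have hcb : u b ⬝ᵥ c = 0 := hc b (Finset.mem_insert_self _ _)
      have hcb' : c ⬝ᵥ u b = 0 := by rw [dotProduct_comm]; exact hcb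
      have e3 : ∀ A, G A x = Real.exp (-x ^ 2) * (weight θ A * Real.exp
          (∑ b ∈ s, (u b ⬝ᵥ noise θ A) ^ 2 + (c + (2 * x) • u b) ⬝ᵥ noise θ A)) := by
        intro A
        simp only [hG, add_dotProduct, smul_dotProduct, smul_eq_mul, Real.exp_add]
        ring_nf
      simp_rw [e3, ← Finset.mul_sum]
      refine (mul_le_mul_of_nonneg_left key (Real.exp_nonneg _)).trans ?_
      -- No cross term, and `u b` has norm at most one, so the shift costs at most `exp(x²/2)`. The
      -- remaining `exp(-x²/2)` integrates to `√π * √2`, one factor `√2` per direction.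
      have e4 : (c + (2 * x) • u b) ⬝ᵥ (c + (2 * x) • u b) =
          c ⬝ᵥ c + 4 * x ^ 2 * (u b ⬝ᵥ u b) := by
        simp only [add_dotProduct, dotProduct_add, smul_dotProduct, dotProduct_smul, smul_eq_mul,
          hcb, hcb']
        ring
      rw [e4, mul_left_comm, mul_assoc (√2 ^ #s)]
      refine mul_le_mul_of_nonneg_left ?_ (pow_nonneg (Real.sqrt_nonneg 2) _)
      rw [← Real.exp_add, ← Real.exp_add]
      refine Real.exp_le_exp.mpr ?_
      nlinarith [hu1 b, sq_nonneg x]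
    have e5 : ∫ x, ∑ A, G A x ≤
        ∫ x, √2 ^ s.card * Real.exp (c ⬝ᵥ c / 8) * Real.exp (-(1 / 2) * x ^ 2) :=
      integral_mono (integrable_finsetSum _ fun A _ => hGi A)
        ((integrable_exp_neg_mul_sq (by norm_num)).const_mul _) e2
    rw [← e1, integral_const_mul, integral_gaussian] at e5
    have e6 : √(Real.pi / (1 / 2)) = √Real.pi * √2 := by
      rw [← Real.sqrt_mul Real.pi_pos.le]; congr 1; ring
    rw [e6] at e5
    rw [Finset.card_insert_of_notMem hb, pow_succ]
    refine le_of_mul_le_mul_left (e5.trans (le_of_eq ?_)) hπ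
    ring

end Weight

/-! ### Block averages and the least squares inequality -/

section Projection

variable {P B : Type*} [Fintype P] [DecidableEq B]

/-- The normalized indicator of the block `h ⁻¹ b`. -/
noncomputable def blockVec (h : P → B) (b : B) (p : P) : ℝ :=
  if h p = b then (√(#{q | h q = b} : ℝ))⁻¹ else 0

lemma blockVec_dotProduct_self_le (h : P → B) (b : B) :
    blockVec h b ⬝ᵥ blockVec h b ≤ 1 := by
  have : ∀ p, blockVec h b p * blockVec h b p =
      if h p = b then ((#{q | h q = b} : ℝ))⁻¹ else 0 := by
    intro p
    simp only [blockVec]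
    split_ifs
    · rw [← mul_inv, Real.mul_self_sqrt (Nat.cast_nonneg _)]
    · simp
  simp only [dotProduct, this]
  rw [← Finset.sum_filter, Finset.sum_const, nsmul_eq_mul]
  exact mul_inv_le_one

lemma blockVec_dotProduct_of_ne (h : P → B) {a b : B} (hab : a ≠ b) :
    blockVec h a ⬝ᵥ blockVec h b = 0 := by
  refine Finset.sum_eq_zero fun p _ => ?_
  simp only [blockVec]
  split_ifs with h1 h2 <;> simp_all

lemma sum_blockVec (h : P → B) (b : B) (x : P → ℝ) :
    blockVec h b ⬝ᵥ x = (√(#{q | h q = b} : ℝ))⁻¹ * ∑ p with h p = b, x p := by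
  rw [Finset.sum_filter, Finset.mul_sum]
  refine Finset.sum_congr rfl fun p _ => ?_
  simp only [blockVec]
  split_ifs <;> simp

variable [Fintype B]

/-- The orthogonal projection onto the functions constant on the fibres of `h`. -/
noncomputable def blockProj (h : P → B) (x : P → ℝ) : P → ℝ :=
  ∑ b, (blockVec h b ⬝ᵥ x) • blockVec h b

lemma blockProj_add (h : P → B) (x y : P → ℝ) :
    blockProj h (x + y) = blockProj h x + blockProj h y := by
  simp only [blockProj, dotProduct_add, add_smul, Finset.sum_add_distrib]

lemma blockProj_apply (h : P → B) (x : P → ℝ) (p : P) :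
    blockProj h x p = (#{q | h q = h p} : ℝ)⁻¹ * ∑ q with h q = h p, x q := by
  simp only [blockProj, Finset.sum_apply, Pi.smul_apply, smul_eq_mul]
  rw [Finset.sum_eq_single (h p)]
  · rw [sum_blockVec]
    simp only [blockVec, if_true]
    rw [mul_right_comm, ← mul_inv, Real.mul_self_sqrt (Nat.cast_nonneg _)]
  · intro b _ hb
    simp [blockVec, hb.symm]
  · simp

lemma blockProj_comp (h : P → B) (f : B → ℝ) : blockProj h (f ∘ h) = f ∘ h := by
  funext p
  rw [blockProj_apply]
  have : ∑ q with h q = h p, (f ∘ h) q = ∑ q with h q = h p, f (h p) :=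
    Finset.sum_congr rfl fun q hq => by
      rw [Function.comp_apply, (Finset.mem_filter.mp hq).2]
  rw [this, Finset.sum_const, nsmul_eq_mul, ← mul_assoc, inv_mul_cancel₀, one_mul]
  · rfl
  · have : 0 < #{q | h q = h p} := Finset.card_pos.mpr ⟨p, by simp⟩
    positivity

lemma blockVec_dotProduct_blockProj (h : P → B) (b : B) (x : P → ℝ) :
    blockVec h b ⬝ᵥ blockProj h x = blockVec h b ⬝ᵥ x := by
  rw [sum_blockVec, sum_blockVec]
  congr 1
  have : ∀ p ∈ univ.filter (fun p => h p = b), blockProj h x p =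
      (#{q | h q = b} : ℝ)⁻¹ * ∑ q with h q = b, x q := by
    intro p hp
    rw [blockProj_apply, (Finset.mem_filter.mp hp).2]
  rw [Finset.sum_congr rfl this, Finset.sum_const, nsmul_eq_mul, ← mul_assoc]
  rcases Finset.eq_empty_or_nonempty (univ.filter fun p => h p = b) with h0 | h0
  · simp [h0]
  · have : 0 < #{q | h q = b} := Finset.card_pos.mpr h0
    rw [mul_inv_cancel₀ (by positivity), one_mul]

lemma sub_blockProj_dotProduct_blockProj (h : P → B) (x y : P → ℝ) :
    (x - blockProj h x) ⬝ᵥ blockProj h y = 0 := by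
  conv_lhs => rw [blockProj.eq_def h y]
  rw [dotProduct_sum]
  refine Finset.sum_eq_zero fun b _ => ?_
  rw [dotProduct_smul, dotProduct_comm (x - blockProj h x), dotProduct_sub,
    blockVec_dotProduct_blockProj]
  simp

lemma blockProj_dotProduct_self (h : P → B) (x : P → ℝ) :
    blockProj h x ⬝ᵥ blockProj h x = ∑ b, (blockVec h b ⬝ᵥ x) ^ 2 := by
  conv_lhs => rw [blockProj.eq_def]
  rw [sum_dotProduct]
  refine Finset.sum_congr rfl fun b _ => ?_
  rw [smul_dotProduct]
  change (blockVec h b ⬝ᵥ x) • (blockVec h b ⬝ᵥ blockProj h x) = _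
  rw [blockVec_dotProduct_blockProj, smul_eq_mul, pow_two]

/-- The deterministic least squares inequality: if the fit of `A` by the block structure `h` is at
least as good as that by a structure `g` compatible with `θ`, the error is controlled by the noise
`A - θ`. -/
lemma least_squares_le (h g : P → B) (f : B → ℝ) (θ A : P → ℝ) (hθ : θ = f ∘ g)
    (hmin : (A - blockProj h A) ⬝ᵥ (A - blockProj h A) ≤
      (A - blockProj g A) ⬝ᵥ (A - blockProj g A)) :
    (blockProj h A - θ) ⬝ᵥ (blockProj h A - θ) ≤
      2 * ((-2 : ℝ) * ((θ - blockProj h θ) ⬝ᵥ (A - θ))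
          - (θ - blockProj h θ) ⬝ᵥ (θ - blockProj h θ) / 2) +
        3 * ∑ b, (blockVec h b ⬝ᵥ (A - θ)) ^ 2 := by
  rw [← blockProj_dotProduct_self]
  obtain ⟨E, rfl⟩ : ∃ E, A = θ + E := ⟨A - θ, by simp⟩
  simp only [add_sub_cancel_left]
  have hg : (θ + E - blockProj g (θ + E)) = E - blockProj g E := by
    rw [blockProj_add, hθ, blockProj_comp]
    abel
  rw [hg, blockProj_add] at hmin
  rw [blockProj_add]
  have o1 := sub_blockProj_dotProduct_blockProj h θ E
  have o2 := sub_blockProj_dotProduct_blockProj h E E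
  have o3 := sub_blockProj_dotProduct_blockProj g E E
  have n3 : 0 ≤ blockProj g E ⬝ᵥ blockProj g E := by
    rw [blockProj_dotProduct_self]; positivity
  set v := θ - blockProj h θ with hv
  set Q := blockProj h E with hQ
  set R := blockProj g E with hR
  have a1 : θ + E - (blockProj h θ + Q) = v + (E - Q) := by rw [hv]; abel
  have a2 : blockProj h θ + Q - θ = Q - v := by rw [hv]; abel
  rw [a1] at hmin
  rw [a2]
  have c1 : Q ⬝ᵥ v = v ⬝ᵥ Q := dotProduct_comm _ _
  have c2 : E ⬝ᵥ v = v ⬝ᵥ E := dotProduct_comm _ _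
  have c3 : Q ⬝ᵥ E = E ⬝ᵥ Q := dotProduct_comm _ _
  have c4 : R ⬝ᵥ E = E ⬝ᵥ R := dotProduct_comm _ _
  -- By orthogonality the error is `|v|² + |Q|²`, and minimality reads `|v|² ≤ -2 v·E + |Q|² -
  -- |R|²`. Doubling the latter after dropping `|R|²` leaves a spare `-|v|²`, which will offset the
  -- exponential moment of the linear term.
  simp only [add_dotProduct, sub_dotProduct, dotProduct_add, dotProduct_sub] at *
  linarith

end Projection

/-! ### Risk of least squares and the minimax upper bound -/

lemma le_add_exp_sub (x L : ℝ) : x ≤ L - 1 + Real.exp (x - L) := by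
  linarith [Real.add_one_le_exp (x - L)]

/-- The risk bound for the least squares estimator over a finite family of block structures. -/
lemma exists_estimator {P B H : Type*} [Fintype P] [Fintype B] [Fintype H] [Nonempty H]
    [DecidableEq B] [DecidableEq P] (h : H → P → B) :
    ∃ T : (P → Bool) → P → ℝ, ∀ (θ : P → ℝ) (_ : ∀ p, 0 ≤ θ p) (_ : ∀ p, θ p ≤ 1)
      (g : H) (f : B → ℝ) (_ : θ = f ∘ h g),
      ∑ A, weight θ A * ∑ p, (T A p - θ p) ^ 2 ≤
        5 * Real.log (Fintype.card H) + 3 * Fintype.card B := by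
  set obs : (P → Bool) → P → ℝ := fun A p => if A p then 1 else 0 with hobs
  have hex : ∀ A : P → Bool, ∃ z : H, ∀ g : H,
      (obs A - blockProj (h z) (obs A)) ⬝ᵥ (obs A - blockProj (h z) (obs A)) ≤
      (obs A - blockProj (h g) (obs A)) ⬝ᵥ (obs A - blockProj (h g) (obs A)) :=
    fun A => Finite.exists_min _
  choose z hz using hex
  refine ⟨fun A => blockProj (h (z A)) (obs A), fun θ h0 h1 g f hθ => ?_⟩
  have hw := weight_nonneg h0 h1
  have hcard : (0 : ℝ) < Fintype.card H := by exact_mod_cast Fintype.card_pos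
  set v : H → P → ℝ := fun c => θ - blockProj (h c) θ with hv
  -- The term `-|v|²/2` cancels exactly the Hoeffding factor `exp(4|v|²/8)` of `-2 v·noise`.
  set X : H → (P → Bool) → ℝ := fun c A =>
    (-2 : ℝ) * (v c ⬝ᵥ noise θ A) - v c ⬝ᵥ v c / 2 with hX
  set Y : H → (P → Bool) → ℝ := fun c A => ∑ b, (blockVec (h c) b ⬝ᵥ noise θ A) ^ 2 with hY
  set L₁ := Real.log (Fintype.card H) with hL₁
  set L₂ := Real.log (Fintype.card H * √2 ^ Fintype.card B) with hL₂
  have hXe : ∀ c, ∑ A, weight θ A * Real.exp (X c A) ≤ 1 := by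
    intro c
    have := sum_weight_mul_exp_le h0 h1 ((-2 : ℝ) • v c)
    have e : ∀ A, Real.exp (X c A) =
        Real.exp (-(v c ⬝ᵥ v c / 2)) * Real.exp (((-2 : ℝ) • v c) ⬝ᵥ noise θ A) := by
      intro A
      rw [← Real.exp_add, smul_dotProduct, smul_eq_mul]
      congr 1
      simp only [hX]; ring
    simp_rw [e, mul_left_comm _ (Real.exp (-(v c ⬝ᵥ v c / 2))), ← Finset.mul_sum]
    refine (mul_le_mul_of_nonneg_left this (Real.exp_nonneg _)).trans (le_of_eq ?_)
    rw [← Real.exp_add, Real.exp_eq_one_iff]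
    simp only [smul_dotProduct, dotProduct_smul, smul_eq_mul]
    ring
  have hYe : ∀ c, ∑ A, weight θ A * Real.exp (Y c A) ≤ √2 ^ Fintype.card B := by
    intro c
    have := sum_weight_mul_exp_sq_le h0 h1 (blockVec (h c))
      (fun a b hab => blockVec_dotProduct_of_ne (h c) hab) (blockVec_dotProduct_self_le (h c))
      Finset.univ 0 (by simp)
    simpa using this
  -- The selected `z A` depends on the data, so its exponential is bounded by the sum over all
  -- structures. The choice `L = log(|H| M)` brings the expectation of that sum, scaled by
  -- `exp(-L)`, down to at most 1.
  have hmax : ∀ (W : H → (P → Bool) → ℝ) (M : ℝ), 0 < M →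
      (∀ c, ∑ A, weight θ A * Real.exp (W c A) ≤ M) →
      ∑ A, weight θ A * W (z A) A ≤ Real.log (Fintype.card H * M) := by
    intro W M hM hWM
    set L := Real.log (Fintype.card H * M) with hL
    have s1 : ∀ A, weight θ A * W (z A) A ≤
        weight θ A * (L - 1) + ∑ c, weight θ A * Real.exp (W c A) * Real.exp (-L) := by
      intro A
      have t1 := le_add_exp_sub (W (z A) A) L
      have t2 : weight θ A * Real.exp (W (z A) A) * Real.exp (-L) ≤
          ∑ c, weight θ A * Real.exp (W c A) * Real.exp (-L) :=
        Finset.single_le_sum (f := fun c => weight θ A * Real.exp (W c A) * Real.exp (-L))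
          (fun c _ => mul_nonneg (mul_nonneg (hw A) (Real.exp_nonneg _)) (Real.exp_nonneg _))
          (Finset.mem_univ _)
      refine le_trans ?_ (add_le_add_right t2 _)
      rw [mul_assoc, ← Real.exp_add, ← sub_eq_add_neg, ← mul_add]
      exact mul_le_mul_of_nonneg_left t1 (hw A)
    refine (Finset.sum_le_sum fun A _ => s1 A).trans ?_
    rw [Finset.sum_add_distrib, ← Finset.sum_mul, sum_weight, Finset.sum_comm]
    have s2 : ∑ c, ∑ A, weight θ A * Real.exp (W c A) * Real.exp (-L) ≤ 1 := by
      calc _ ≤ ∑ c : H, M * Real.exp (-L) := Finset.sum_le_sum fun c _ => by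
            rw [← Finset.sum_mul]
            exact mul_le_mul_of_nonneg_right (hWM c) (Real.exp_nonneg _)
        _ = 1 := by
            rw [Finset.sum_const, Finset.card_univ, nsmul_eq_mul, ← mul_assoc, Real.exp_neg, hL,
              Real.exp_log (by positivity), mul_inv_cancel₀ (by positivity)]
    linarith
  have m1 := hmax X 1 one_pos hXe
  have m2 := hmax Y _ (by positivity) hYe
  rw [mul_one] at m1
  have hlog : Real.log (Fintype.card H * √2 ^ Fintype.card B) ≤
      Real.log (Fintype.card H) + Fintype.card B := by
    rw [Real.log_mul (by positivity) (by positivity), Real.log_pow]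
    have : Real.log √2 ≤ 1 := by
      rw [Real.log_sqrt (by norm_num)]
      linarith [Real.log_two_lt_d9]
    nlinarith [Nat.cast_nonneg (α := ℝ) (Fintype.card B)]
  have hdet : ∀ A, ∑ p, (blockProj (h (z A)) (obs A) p - θ p) ^ 2 ≤
      2 * X (z A) A + 3 * Y (z A) A := by
    intro A
    have := least_squares_le (h (z A)) (h g) f θ (obs A) hθ (hz A g)
    refine le_trans (le_of_eq ?_) this
    simp [dotProduct, pow_two]
  -- The constants come from `2 log|H| + 3 (log|H| + |B|)`.
  calc _ ≤ ∑ A, weight θ A * (2 * X (z A) A + 3 * Y (z A) A) :=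
        Finset.sum_le_sum fun A _ => mul_le_mul_of_nonneg_left (hdet A) (hw A)
    _ = 2 * ∑ A, weight θ A * X (z A) A + 3 * ∑ A, weight θ A * Y (z A) A := by
        rw [Finset.mul_sum, Finset.mul_sum, ← Finset.sum_add_distrib]
        exact Finset.sum_congr rfl fun A _ => by ring
    _ ≤ _ := by linarith

lemma dataLaw_singleton {n m : ℕ} (θ : Matrix (Fin n) (Fin m) I) (A : Data n m) :
    dataLaw θ {A} = ENNReal.ofReal (weight (fun p : Fin n × Fin m => (θ p.1 p.2 : ℝ)) A) := by
  rw [dataLaw, Measure.pi_singleton, weight, ENNReal.ofReal_prod_of_nonneg]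
  · refine Finset.prod_congr rfl fun p _ => ?_
    rw [bernoulliMeasure_apply _ (measurableSet_singleton _)]
    cases A p
    · simp only [Set.mem_singleton_iff, reduceCtorEq, if_false, if_true]
      rw [ENNReal.ofReal, Real.toNNReal_of_nonneg (sub_nonneg.mpr (θ p.1 p.2).2.2)]
      rfl
    · simp only [Set.mem_singleton_iff, reduceCtorEq, if_false, if_true]
      rw [ENNReal.ofReal, Real.toNNReal_of_nonneg (θ p.1 p.2).2.1]
      rfl
  · intro p _
    have := (θ p.1 p.2).2.1
    have := (θ p.1 p.2).2.2
    split_ifs <;> linarith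

lemma loss_nonneg {n m : ℕ} (T : Matrix (Fin n) (Fin m) ℝ) (θ : Matrix (Fin n) (Fin m) I) :
    0 ≤ loss T θ := by
  unfold loss; positivity

lemma risk_eq {n m : ℕ} (T : Estimator n m) (θ : Matrix (Fin n) (Fin m) I) :
    risk T θ = ENNReal.ofReal
      (∑ A, weight (fun p : Fin n × Fin m => (θ p.1 p.2 : ℝ)) A * loss (T A) θ) := by
  have hw := weight_nonneg (θ := fun p : Fin n × Fin m => (θ p.1 p.2 : ℝ))
    (fun p => (θ p.1 p.2).2.1) (fun p => (θ p.1 p.2).2.2)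
  rw [risk, lintegral_fintype, ENNReal.ofReal_sum_of_nonneg
    fun A _ => mul_nonneg (hw A) (loss_nonneg _ _)]
  refine Finset.sum_congr rfl fun A _ => ?_
  rw [dataLaw_singleton, ENNReal.ofReal_mul (hw A), mul_comm]

lemma loss_eq {n m : ℕ} (T : Matrix (Fin n) (Fin m) ℝ) (θ : Matrix (Fin n) (Fin m) I) :
    loss T θ = 1 / ((n : ℝ) * m) * ∑ p : Fin n × Fin m, (T p.1 p.2 - θ p.1 p.2) ^ 2 := by
  rw [loss, Fintype.sum_prod_type]

theorem minimaxRisk_le {n m k l : ℕ} (hk : 1 ≤ k) (hkn : k ≤ n) (hl : 1 ≤ l) (hlm : l ≤ m) :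
    minimaxRisk n m k l ≤ ENNReal.ofReal (5 * rate n m k l) := by
  have : NeZero k := ⟨by omega⟩
  have : NeZero l := ⟨by omega⟩
  have hn : (0 : ℝ) < n := by exact_mod_cast (by omega : 0 < n)
  have hm : (0 : ℝ) < m := by exact_mod_cast (by omega : 0 < m)
  obtain ⟨T, hT⟩ := exists_estimator (P := Fin n × Fin m) (B := Fin k × Fin l)
    (H := (Fin n → Fin k) × (Fin m → Fin l)) (fun c p => (c.1 p.1, c.2 p.2))
  refine (iInf_le _ (fun A => Matrix.of fun i j => T A (i, j))).trans (iSup₂_le fun θ hθ => ?_)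
  obtain ⟨Q, z₁, z₂, hQ⟩ := hθ
  rw [risk_eq]
  refine ENNReal.ofReal_le_ofReal ?_
  have key := hT (fun p => (θ p.1 p.2 : ℝ)) (fun p => (θ p.1 p.2).2.1) (fun p => (θ p.1 p.2).2.2)
    (z₁, z₂) (fun b => Q b.1 b.2) (by funext p; simp [hQ])
  simp_rw [loss_eq, Matrix.of_apply, mul_left_comm _ (1 / ((n : ℝ) * m)), ← Finset.mul_sum]
  refine (mul_le_mul_of_nonneg_left key (by positivity)).trans ?_
  have hk' : (0 : ℝ) < k := by exact_mod_cast hk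
  have hl' : (0 : ℝ) < l := by exact_mod_cast hl
  simp only [Fintype.card_prod, Fintype.card_fun, Fintype.card_fin]
  push_cast
  rw [Real.log_mul (by positivity) (by positivity), Real.log_pow, Real.log_pow, rate]
  have : 0 ≤ (k : ℝ) * l := by positivity
  calc _ ≤ 1 / ((n : ℝ) * m) * (5 * (n * Real.log k + m * Real.log l) + 5 * (k * l)) := by
        gcongr; norm_num
    _ = _ := by field_simp; ring

/-! ### Multiple testing and Assouad's reduction -/

/-- Estimating one of `card κ` hypotheses whose densities have second moment at most
`9 / 16 * card κ` with respect to a common reference `q`. -/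
lemma multiple_testing_lower_bound {Ω κ : Type*} [Fintype Ω] [Fintype κ] [Nonempty κ]
    [DecidableEq κ] {q : Ω → ℝ} (hq : ∀ A, 0 ≤ q A) (hq1 : ∑ A, q A = 1) {L d : κ → Ω → ℝ}
    (hL : ∀ a A, 0 ≤ L a A) (hL1 : ∀ a, ∑ A, q A * L a A = 1)
    (hL2 : ∀ a, ∑ A, q A * L a A ^ 2 ≤ 9 / 16 * Fintype.card κ) {D : ℝ}
    (hd : ∀ a A, 0 ≤ d a A) (hD : ∀ a b A, a ≠ b → D ≤ d a A + d b A) (hD0 : 0 ≤ D) :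
    D / 8 * Fintype.card κ ≤ ∑ a, ∑ A, q A * L a A * d a A := by
  choose ψ hψ using fun A => Finite.exists_min (fun a => d a A)
  set K : ℝ := (Fintype.card κ : ℝ) with hK
  have hK0 : 0 < K := by simp only [hK]; exact_mod_cast Fintype.card_pos
  -- `ψ` is the minimum distance test. When it misses `a`, separation and minimality give `d a A ≥ D
  -- / 2`.
  have h1 : ∀ a A, D / 2 * (q A * L a A - if a = ψ A then q A * L (ψ A) A else 0) ≤
      q A * L a A * d a A := by
    intro a A
    have hqL : 0 ≤ q A * L a A := mul_nonneg (hq A) (hL a A)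
    split_ifs with h
    · subst h
      have := mul_nonneg hqL (hd (ψ A) A)
      simpa using this
    · have := hD a (ψ A) A h
      have := hψ A a
      rw [sub_zero, mul_comm]
      exact mul_le_mul_of_nonneg_left (by linarith) hqL
  -- AM-GM, balanced so that both terms contribute `3/8 K` to the total success probability. At
  -- least `K/4` is left for errors, each costing `D/2`.
  have h2 : ∀ A, q A * L (ψ A) A ≤ 3 / 8 * K * q A + 2 / (3 * K) * ∑ a, q A * L a A ^ 2 := by
    intro A
    have s1 : q A * L (ψ A) A ^ 2 ≤ ∑ a, q A * L a A ^ 2 :=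
      Finset.single_le_sum (f := fun a => q A * L a A ^ 2)
        (fun a _ => mul_nonneg (hq A) (sq_nonneg _)) (Finset.mem_univ _)
    have s2 : L (ψ A) A ≤ 3 / 8 * K + 2 / (3 * K) * L (ψ A) A ^ 2 := by
      have : 3 / 8 * K + 2 / (3 * K) * L (ψ A) A ^ 2 - L (ψ A) A =
          2 / (3 * K) * (L (ψ A) A - 3 / 4 * K) ^ 2 := by
        field_simp; ring
      have h3 : 0 ≤ 2 / (3 * K) * (L (ψ A) A - 3 / 4 * K) ^ 2 := by positivity
      linarith
    have s3 := mul_le_mul_of_nonneg_left s2 (hq A)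
    have s4 := mul_le_mul_of_nonneg_left s1 (by positivity : 0 ≤ 2 / (3 * K))
    nlinarith
  have h3 : ∑ A, q A * L (ψ A) A ≤ 3 / 4 * K := by
    refine (Finset.sum_le_sum fun A _ => h2 A).trans ?_
    rw [Finset.sum_add_distrib, ← Finset.mul_sum, ← Finset.mul_sum, hq1, Finset.sum_comm]
    have : ∑ a, ∑ A, q A * L a A ^ 2 ≤ 9 / 16 * K * K := by
      refine (Finset.sum_le_sum fun a _ => hL2 a).trans (le_of_eq ?_)
      rw [Finset.sum_const, Finset.card_univ, nsmul_eq_mul]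
      ring
    have := mul_le_mul_of_nonneg_left this (by positivity : 0 ≤ 2 / (3 * K))
    have e : 2 / (3 * K) * (9 / 16 * K * K) = 3 / 8 * K := by field_simp; norm_num
    linarith
  refine le_trans ?_ (Finset.sum_le_sum fun a _ => Finset.sum_le_sum fun A _ => h1 a A)
  simp_rw [← Finset.mul_sum, Finset.sum_sub_distrib]
  have e1 : ∑ a, ∑ A, q A * L a A = K := by simp [hL1, hK]
  have e2 : ∑ a, ∑ A, (if a = ψ A then q A * L (ψ A) A else 0) = ∑ A, q A * L (ψ A) A := by
    rw [Finset.sum_comm]; simp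
  rw [e1, e2]
  nlinarith

/-- Resampling one coordinate of a uniformly distributed function. -/
lemma sum_sum_update {ι κ : Type*} [Fintype ι] [DecidableEq ι] [Fintype κ] (i : ι)
    (F : (ι → κ) → ℝ) :
    ∑ z, ∑ a, F (Function.update z i a) = Fintype.card κ * ∑ z, F z := by
  -- Exchanging the old label at `i` with the fresh one is an involution on pairs.
  let e : (ι → κ) × κ ≃ (ι → κ) × κ :=
    Function.Involutive.toPerm (fun x => (Function.update x.1 i x.2, x.1 i)) fun x => by simp
  have h := Equiv.sum_comp e (fun x => F x.1)
  rw [Fintype.sum_prod_type, Fintype.sum_prod_type] at h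
  have e1 : ∀ z a, (e (z, a)).1 = Function.update z i a := fun _ _ => rfl
  simpa [e1, Finset.mul_sum] using h

/-- The sign of a bit. -/
def bitSign (x : Bool) : ℝ := if x then 1 else -1

lemma bitSign_sq (x : Bool) : bitSign x ^ 2 = 1 := by
  cases x <;> simp [bitSign]

lemma weight_half_add {P : Type*} [Fintype P] (δ : ℝ) (t : P → ℝ) (A : P → Bool) :
    weight (fun p => 1 / 2 + δ * t p) A = ∏ p, (1 / 2 + δ * t p * bitSign (A p)) := by
  refine Finset.prod_congr rfl fun p _ => ?_
  simp only [bitSign]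
  split_ifs <;> ring

section Assouad

variable {P ι κ : Type*} [Fintype P] [DecidableEq P] [DecidableEq ι] [Fintype κ] [DecidableEq κ]

/-- The estimation error in the `i`-th group when only the `i`-th label is random. -/
lemma conditional_lower_bound [Nonempty κ] {g : P → ι} {s : κ → P → ℝ}
    (hs : ∀ a p, s a p ^ 2 = 1) {δ : ℝ} (hδ : 0 ≤ δ) (hδ2 : δ ≤ 1 / 2) (i : ι)
    (hchi : (1 + 4 * δ ^ 2) ^ #{p | g p = i} ≤ 9 / 16 * (Fintype.card κ : ℝ)) {D : ℝ} (hD0 : 0 ≤ D)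
    (hD : ∀ a b, a ≠ b → D ≤ ∑ p with g p = i, (s a p - s b p) ^ 2)
    (T : (P → Bool) → P → ℝ) (z : ι → κ) :
    δ ^ 2 * D / 16 * Fintype.card κ ≤
      ∑ a, ∑ A, weight (fun p => 1 / 2 + δ * s (Function.update z i a (g p)) p) A *
        ∑ p with g p = i, (T A p - (1 / 2 + δ * s (Function.update z i a (g p)) p)) ^ 2 := by
  -- The reference law `q` makes group `i` fair coins and keeps the other groups as `z` prescribes;
  -- `L a` is the likelihood ratio for label `a` in group `i`.
  set t₀ : P → ℝ := fun p => if g p = i then 0 else s (z (g p)) p with ht₀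
  set q : (P → Bool) → ℝ := weight (fun p => 1 / 2 + δ * t₀ p) with hq
  set L : κ → (P → Bool) → ℝ := fun a A =>
    ∏ p, if g p = i then 1 + 2 * δ * s a p * bitSign (A p) else 1 with hL
  have hpm : ∀ a p (x : Bool), -1 ≤ s a p * bitSign x ∧ s a p * bitSign x ≤ 1 := by
    intro a p x
    refine abs_le.mp ((sq_le_one_iff_abs_le_one _).mp ?_)
    rw [mul_pow, hs, bitSign_sq, one_mul]
  have hs1 : ∀ a p, -1 ≤ s a p ∧ s a p ≤ 1 := fun a p =>
    abs_le.mp ((sq_le_one_iff_abs_le_one _).mp (hs a p).le)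
  have ht₀1 : ∀ p, -1 ≤ t₀ p ∧ t₀ p ≤ 1 := by
    intro p
    simp only [ht₀]
    split_ifs
    · norm_num
    · exact hs1 _ _
  have hqL : ∀ a A, q A * L a A =
      weight (fun p => 1 / 2 + δ * s (Function.update z i a (g p)) p) A := by
    intro a A
    rw [hq, hL, weight_half_add, weight_half_add, ← Finset.prod_mul_distrib]
    refine Finset.prod_congr rfl fun p _ => ?_
    simp only [ht₀]
    split_ifs with h
    · rw [h, Function.update_self]; ring
    · rw [Function.update_of_ne h]; ring
  have key := multiple_testing_lower_bound (q := q) (L := L)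
    (d := fun a A => ∑ p with g p = i, (T A p - (1 / 2 + δ * s a p)) ^ 2) (D := δ ^ 2 * D / 2)
    (fun A => weight_nonneg (fun p => by nlinarith [ht₀1 p]) (fun p => by nlinarith [ht₀1 p]) A)
    (sum_weight _)
    (fun a A => Finset.prod_nonneg fun p _ => by
      split_ifs
      · nlinarith [hpm a p (A p)]
      · norm_num)
    (fun a => by simp_rw [hqL]; exact sum_weight _)
    (fun a => by
      -- Each coordinate of group `i` contributes the fair-coin mean of `(1 ± 2δ)²`, namely `1 +
      -- 4δ²`; every other coordinate contributes 1.
      refine le_trans (le_of_eq ?_) hchi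
      have h1 : ∀ A, q A * L a A ^ 2 = ∏ p, (1 / 2 + δ * t₀ p * bitSign (A p)) *
          (if g p = i then 1 + 2 * δ * s a p * bitSign (A p) else 1) ^ 2 := by
        intro A
        rw [hq, hL, weight_half_add, ← Finset.prod_pow, ← Finset.prod_mul_distrib]
      simp_rw [h1]
      rw [sum_prod_bool (fun p x => (1 / 2 + δ * t₀ p * bitSign x) *
          (if g p = i then 1 + 2 * δ * s a p * bitSign x else 1) ^ 2),
        ← Finset.prod_const, Finset.prod_filter]
      refine Finset.prod_congr rfl fun p _ => ?_
      have h2 := hs a p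
      have b1 : bitSign true = 1 := rfl
      have b0 : bitSign false = -1 := rfl
      simp only [ht₀, b1, b0]
      split_ifs
      · linear_combination (4 * δ ^ 2) * h2
      · ring)
    (fun a A => Finset.sum_nonneg fun p _ => sq_nonneg _)
    (fun a b A hab => by
      rw [← Finset.sum_add_distrib]
      calc δ ^ 2 * D / 2 ≤ δ ^ 2 * (∑ p with g p = i, (s a p - s b p) ^ 2) / 2 := by
            gcongr; exact hD a b hab
        _ = ∑ p with g p = i, δ ^ 2 * (s a p - s b p) ^ 2 / 2 := by
            rw [Finset.mul_sum, Finset.sum_div]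
        _ ≤ _ := Finset.sum_le_sum fun p _ => by
            nlinarith [sq_nonneg ((T A p - (1 / 2 + δ * s a p)) + (T A p - (1 / 2 + δ * s b p)))])
    (by positivity)
  refine (le_of_eq (by ring)).trans (key.trans (le_of_eq ?_))
  refine Finset.sum_congr rfl fun a _ => Finset.sum_congr rfl fun A _ => ?_
  rw [hqL]
  congr 1
  refine Finset.sum_congr rfl fun p hp => ?_
  rw [(Finset.mem_filter.mp hp).2, Function.update_self]

/-- Assouad's lemma for arrays of Bernoulli variables whose groups carry labels in `κ`: some
labelling makes the estimation error at least the sum of the errors of the separate groups. -/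
lemma exists_labelling_lower_bound [Fintype ι] [Nonempty κ] {g : P → ι} {s : κ → P → ℝ}
    (hs : ∀ a p, s a p ^ 2 = 1) {δ : ℝ} (hδ : 0 ≤ δ) (hδ2 : δ ≤ 1 / 2)
    (hchi : ∀ i, (1 + 4 * δ ^ 2) ^ #{p | g p = i} ≤ 9 / 16 * (Fintype.card κ : ℝ)) {D : ℝ}
    (hD0 : 0 ≤ D) (hD : ∀ i a b, a ≠ b → D ≤ ∑ p with g p = i, (s a p - s b p) ^ 2)
    (T : (P → Bool) → P → ℝ) :
    ∃ z : ι → κ, Fintype.card ι * (δ ^ 2 * D / 16) ≤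
      ∑ A, weight (fun p => 1 / 2 + δ * s (z (g p)) p) A *
        ∑ p, (T A p - (1 / 2 + δ * s (z (g p)) p)) ^ 2 := by
  have hK : (0 : ℝ) < Fintype.card κ := by exact_mod_cast Fintype.card_pos
  -- The labels get a uniform prior: resampling label `i` reduces to the conditional bound, and some
  -- labelling does at least as badly as the average.
  have hcoord : ∀ i, ∑ _z : ι → κ, δ ^ 2 * D / 16 ≤
      ∑ z : ι → κ, ∑ A, weight (fun p => 1 / 2 + δ * s (z (g p)) p) A *
        ∑ p with g p = i, (T A p - (1 / 2 + δ * s (z (g p)) p)) ^ 2 := by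
    intro i
    refine le_of_mul_le_mul_left ?_ hK
    refine le_trans ?_ (sum_sum_update i _).le
    rw [Finset.mul_sum]
    refine Finset.sum_le_sum fun z _ => ?_
    rw [mul_comm (Fintype.card κ : ℝ)]
    exact conditional_lower_bound hs hδ hδ2 i (hchi i) hD0 (hD i) T z
  have htot := Finset.sum_le_sum fun i (_ : i ∈ (Finset.univ : Finset ι)) => hcoord i
  rw [Finset.sum_comm, Finset.sum_comm (s := (Finset.univ : Finset ι))] at htot
  obtain ⟨z, _, hz⟩ := Finset.exists_le_of_sum_le Finset.univ_nonempty htot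
  refine ⟨z, ?_⟩
  rw [Finset.sum_const, Finset.card_univ, nsmul_eq_mul, Finset.sum_comm] at hz
  refine hz.trans (le_of_eq ?_)
  refine Finset.sum_congr rfl fun A _ => ?_
  rw [← Finset.mul_sum, Finset.sum_fiberwise]

end Assouad

/-- A sufficient condition for the chi-square bound in `exists_labelling_lower_bound`. -/
lemma one_add_pow_le {K : ℝ} (hK : 2 ≤ K) {x : ℝ} (hx : 0 ≤ x) {N : ℕ}
    (h : x * N ≤ Real.log K / 32) : (1 + 4 * x) ^ N ≤ 9 / 16 * K := by
  have hK0 : 0 < K := by linarith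
  have h1 : (1 + 4 * x) ^ N ≤ Real.exp (4 * x * N) := by
    rw [mul_comm (4 * x), Real.exp_nat_mul]
    refine pow_le_pow_left₀ (by positivity) ?_ _
    linarith [Real.add_one_le_exp (4 * x)]
  refine h1.trans ?_
  have h2 : Real.exp (4 * x * N) ≤ Real.exp (Real.log K / 8) :=
    Real.exp_le_exp.mpr (by linarith)
  refine h2.trans ?_
  -- After taking eighth powers, what is needed is `(9/16)^8 * K^7 ≥ 1`, which holds already at `K =
  -- 2`.
  refine le_of_pow_le_pow_left₀ (n := 8) (by norm_num) (by positivity) ?_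
  rw [← Real.exp_nat_mul]
  have : ((8 : ℕ) : ℝ) * (Real.log K / 8) = Real.log K := by push_cast; ring
  rw [this, Real.exp_log hK0, mul_pow]
  have h7 : (2 : ℝ) ^ 7 ≤ K ^ 7 := pow_le_pow_left₀ (by norm_num) hK 7
  have : (9 / 16 : ℝ) ^ 8 * K ^ 8 = (9 / 16 : ℝ) ^ 8 * K ^ 7 * K := by ring
  rw [this]
  have : 1 ≤ (9 / 16 : ℝ) ^ 8 * K ^ 7 := by
    have := mul_le_mul_of_nonneg_left h7 (by positivity : (0 : ℝ) ≤ (9 / 16) ^ 8)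
    norm_num at this ⊢
    linarith
  nlinarith

/-- The minimax lower bound attached to a labelled family of block models. -/
lemma minimaxRisk_ge {n m k l : ℕ} (hn : 0 < n) (hm : 0 < m) {ι κ : Type*} [Fintype ι]
    [DecidableEq ι] [Fintype κ] [DecidableEq κ] (hκ : 2 ≤ Fintype.card κ)
    {g : Fin n × Fin m → ι} {s : κ → Fin n × Fin m → ℝ} (hs : ∀ a p, s a p ^ 2 = 1) {x : ℝ}
    (hx : 0 ≤ x) (hx2 : x ≤ 1 / 4)
    (hN : ∀ i, x * #{p | g p = i} ≤ Real.log (Fintype.card κ) / 32) {D : ℝ}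
    (hD0 : 0 ≤ D) (hD : ∀ i a b, a ≠ b → D ≤ ∑ p with g p = i, (s a p - s b p) ^ 2)
    (hmem : ∀ z : ι → κ, ∃ (Q : Fin k → Fin l → ℝ) (z₁ : Fin n → Fin k) (z₂ : Fin m → Fin l),
      (∀ a b, Q a b ^ 2 = 1) ∧ ∀ i j, s (z (g (i, j))) (i, j) = Q (z₁ i) (z₂ j)) :
    ENNReal.ofReal (Fintype.card ι * (x * D) / (16 * (n * m))) ≤ minimaxRisk n m k l := by
  have : Nonempty κ := Fintype.card_pos_iff.mp (by omega)
  set δ := √x with hδ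
  have hδ0 : 0 ≤ δ := Real.sqrt_nonneg _
  have hδsq : δ ^ 2 = x := Real.sq_sqrt hx
  have hδ2 : δ ≤ 1 / 2 := Real.sqrt_le_iff.mpr ⟨by norm_num, by linarith⟩
  refine le_iInf fun T => ?_
  obtain ⟨z, hz⟩ := exists_labelling_lower_bound hs hδ0 hδ2
    (fun i => by
      rw [hδsq]
      exact one_add_pow_le (by exact_mod_cast hκ) hx (hN i))
    hD0 hD (fun A p => T A p.1 p.2)
  obtain ⟨Q, z₁, z₂, hQ, hsQ⟩ := hmem z
  have hQ1 : ∀ a b, 0 ≤ 1 / 2 + δ * Q a b ∧ 1 / 2 + δ * Q a b ≤ 1 := by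
    intro a b
    have := abs_le.mp ((sq_le_one_iff_abs_le_one _).mp (hQ a b).le)
    constructor <;> nlinarith
  let θ : Matrix (Fin n) (Fin m) I := Matrix.of fun i j =>
    ⟨1 / 2 + δ * Q (z₁ i) (z₂ j), hQ1 _ _⟩
  have hθ : θ ∈ parameterSpace n m k l :=
    ⟨Matrix.of fun a b => ⟨1 / 2 + δ * Q a b, hQ1 a b⟩, z₁, z₂, fun i j => rfl⟩
  refine le_iSup₂_of_le θ hθ ?_
  rw [risk_eq]
  refine ENNReal.ofReal_le_ofReal ?_
  have hθeq : ∀ p : Fin n × Fin m, (θ p.1 p.2 : ℝ) = 1 / 2 + δ * s (z (g p)) p := by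
    intro p
    rw [show p = (p.1, p.2) from rfl, hsQ]
    rfl
  simp_rw [loss_eq, hθeq, mul_left_comm _ (1 / ((n : ℝ) * m)), ← Finset.mul_sum]
  have hnm : (0 : ℝ) < n * m := by positivity
  refine le_trans (le_of_eq ?_) (mul_le_mul_of_nonneg_left hz (by positivity))
  rw [hδsq]
  field_simp

/-! ### Walsh codes and balanced labellings -/

/-- The Walsh functions on the hypercube. -/
noncomputable def walsh {r : ℕ} (a b : Fin r → Bool) : ℝ :=
  ∏ i, if a i && b i then -1 else 1

lemma walsh_sq {r : ℕ} (a b : Fin r → Bool) : walsh a b ^ 2 = 1 := by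
  rw [walsh, ← Finset.prod_pow]
  refine Finset.prod_eq_one fun i _ => ?_
  split_ifs <;> norm_num

/-- Distinct Walsh functions are orthogonal: a coordinate where `a` and `b` differ contributes the
factor `1 + (-1) = 0`. -/
lemma sum_walsh_sub_sq {r : ℕ} {a b : Fin r → Bool} (hab : a ≠ b) :
    ∑ c, (walsh a c - walsh b c) ^ 2 = 2 * 2 ^ r := by
  have h0 : ∑ c, walsh a c * walsh b c = 0 := by
    simp only [walsh, ← Finset.prod_mul_distrib]
    rw [sum_prod_bool (fun i x => (if a i && x then (-1 : ℝ) else 1) * if b i && x then -1 else 1)]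
    obtain ⟨i, hi⟩ := Function.ne_iff.mp hab
    refine Finset.prod_eq_zero (Finset.mem_univ i) ?_
    cases h1 : a i <;> cases h2 : b i <;> simp_all
  have e : ∀ c, (walsh a c - walsh b c) ^ 2 = 2 - 2 * (walsh a c * walsh b c) := by
    intro c
    linear_combination walsh_sq a c + walsh_sq b c
  simp_rw [e]
  rw [Finset.sum_sub_distrib, ← Finset.mul_sum, h0]
  simp [mul_comm]

/-- A balanced labelling of `Fin n` by `K ≤ n` labels. -/
lemma exists_balanced {n : ℕ} {κ : Type*} [Fintype κ] [DecidableEq κ] (hK : 0 < Fintype.card κ)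
    (hn : Fintype.card κ ≤ n) :
    ∃ c : Fin n → κ, ∀ a, (n : ℝ) / (2 * Fintype.card κ) ≤ #{i | c i = a} ∧
      (#{i | c i = a} : ℝ) ≤ 2 * n / Fintype.card κ := by
  set K := Fintype.card κ with hKdef
  let e : κ ≃ Fin K := Fintype.equivFin κ
  -- Labels are residues modulo `K`. Classes have size `⌊n/K⌋` or `⌊n/K⌋ + 1`, and `⌊n/K⌋ ≥ 1` keeps
  -- both within a factor two of `n/K`.
  refine ⟨fun i => e.symm ⟨i % K, Nat.mod_lt _ hK⟩, fun a => ?_⟩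
  have hcard : #{i : Fin n | e.symm ⟨i % K, Nat.mod_lt _ hK⟩ = a} =
      n / K + if (e a : ℕ) % K < n % K then 1 else 0 := by
    rw [← Nat.count_modEq_card n hK, Nat.count_eq_card_filter_range, Finset.card_filter,
      Finset.card_filter, ← Fin.sum_univ_eq_sum_range (fun x => if x ≡ e a [MOD K] then 1 else 0)]
    refine Finset.sum_congr rfl fun i _ => if_congr ?_ rfl rfl
    rw [Equiv.symm_apply_eq, Fin.ext_iff, Nat.ModEq, Nat.mod_eq_of_lt (e a).2]
  have hK' : (0 : ℝ) < K := by exact_mod_cast hK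
  have hq : 1 ≤ n / K := (Nat.one_le_div_iff hK).mpr hn
  have h1 : n < K * (n / K + 1) := by
    have := Nat.div_add_mod n K
    have := Nat.mod_lt n hK
    rw [mul_add]; omega
  have h2 : K * (n / K) ≤ n := Nat.mul_div_le n K
  have h1' : (n : ℝ) ≤ K * ((n / K : ℕ) + 1) := by exact_mod_cast h1.le
  have h2' : (K : ℝ) * (n / K : ℕ) ≤ n := by exact_mod_cast h2
  have hq' : (1 : ℝ) ≤ (n / K : ℕ) := by exact_mod_cast hq
  have hlo : n / K ≤ #{i : Fin n | e.symm ⟨i % K, Nat.mod_lt _ hK⟩ = a} := by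
    rw [hcard]; omega
  have hhi : #{i : Fin n | e.symm ⟨i % K, Nat.mod_lt _ hK⟩ = a} ≤ n / K + 1 := by
    rw [hcard]; split_ifs <;> omega
  have hlo' : ((n / K : ℕ) : ℝ) ≤ #{i : Fin n | e.symm ⟨i % K, Nat.mod_lt _ hK⟩ = a} := by
    exact_mod_cast hlo
  have hhi' : (#{i : Fin n | e.symm ⟨i % K, Nat.mod_lt _ hK⟩ = a} : ℝ) ≤ (n / K : ℕ) + 1 := by
    exact_mod_cast hhi
  constructor
  · rw [div_le_iff₀ (by positivity)]
    nlinarith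
  · rw [le_div_iff₀ hK']
    nlinarith

/-! ### The three lower bound designs -/

/-- The lower bound from the unknown block values. -/
lemma minimaxRisk_ge_blocks {n m k l : ℕ} (hk : 1 ≤ k) (hkn : k ≤ n) (hl : 1 ≤ l) (hlm : l ≤ m) :
    ENNReal.ofReal (((k : ℝ) * l) / (n * m) / 4096) ≤ minimaxRisk n m k l := by
  have hn : (0 : ℝ) < n := by exact_mod_cast (by omega : 0 < n)
  have hm : (0 : ℝ) < m := by exact_mod_cast (by omega : 0 < m)
  have hk' : (0 : ℝ) < k := by exact_mod_cast hk
  have hl' : (0 : ℝ) < l := by exact_mod_cast hl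
  have hkn' : (k : ℝ) ≤ n := by exact_mod_cast hkn
  have hlm' : (l : ℝ) ≤ m := by exact_mod_cast hlm
  obtain ⟨z₁, hz₁⟩ := exists_balanced (κ := Fin k) (n := n) (by simpa) (by simpa)
  obtain ⟨z₂, hz₂⟩ := exists_balanced (κ := Fin l) (n := m) (by simpa) (by simpa)
  simp only [Fintype.card_fin] at hz₁ hz₂
  set g : Fin n × Fin m → Fin k × Fin l := fun p => (z₁ p.1, z₂ p.2) with hg
  have hcard : ∀ i : Fin k × Fin l, (#{p | g p = i} : ℝ) = #{x | z₁ x = i.1} * #{y | z₂ y = i.2} := by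
    intro i
    rw [← Nat.cast_mul, ← Finset.card_product]
    congr 2
    ext p
    simp [hg, Prod.ext_iff]
  have hlo : ∀ i, (n : ℝ) * m / (4 * (k * l)) ≤ #{p | g p = i} := by
    intro i
    rw [hcard]
    refine le_trans (le_of_eq ?_) (mul_le_mul (hz₁ i.1).1 (hz₂ i.2).1 (by positivity) (by positivity))
    field_simp; norm_num
  have hhi : ∀ i, (#{p | g p = i} : ℝ) ≤ 4 * (n * m) / (k * l) := by
    intro i
    rw [hcard]
    refine (mul_le_mul (hz₁ i.1).2 (hz₂ i.2).2 (by positivity) (by positivity)).trans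
      (le_of_eq ?_)
    field_simp; norm_num
  have hle : (k : ℝ) * l ≤ n * m := by gcongr
  -- Block sizes lie within a factor 4 of `nm/(kl)`. Hence `x` times a block size is at most `1/64 ≤
  -- log 2 / 32`, and opposite signs, at squared distance 4 per entry, are separated by at least
  -- `nm/(kl)`.
  have key := minimaxRisk_ge (k := k) (l := l) (κ := Bool) (g := g) (s := fun a _ => bitSign a)
    (x := k * l / (n * m) / 256) (D := n * m / (k * l)) (by omega) (by omega) (by simp)
    (fun a p => bitSign_sq a) (by positivity)
    (by
      have : (k : ℝ) * l / (n * m) ≤ 1 := (div_le_one (by positivity)).mpr hle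
      linarith)
    (fun i => by
      have h1 := mul_le_mul_of_nonneg_left (hhi i)
        (by positivity : 0 ≤ (k : ℝ) * l / (n * m) / 256)
      have h2 : (k : ℝ) * l / (n * m) / 256 * (4 * (n * m) / (k * l)) = 1 / 64 := by
        field_simp; norm_num
      rw [Fintype.card_bool, Nat.cast_two]
      linarith [Real.log_two_gt_d9])
    (by positivity)
    (fun i a b hab => by
      have h4 : (bitSign a - bitSign b) ^ 2 = 4 := by
        cases a <;> cases b <;> simp_all [bitSign] <;> norm_num
      rw [Finset.sum_const, nsmul_eq_mul, h4]
      refine le_trans (le_of_eq ?_) (mul_le_mul_of_nonneg_right (hlo i) (by norm_num))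
      field_simp)
    (fun z => ⟨fun a b => bitSign (z (a, b)), z₁, z₂, fun a b => bitSign_sq _, fun i j => rfl⟩)
  refine le_trans (ENNReal.ofReal_le_ofReal (le_of_eq ?_)) key
  simp only [Fintype.card_prod, Fintype.card_fin]
  push_cast
  field_simp
  norm_num

/-- The power of two used for the size of the Walsh code. -/
lemma exists_two_pow {K : ℕ} (hK : 2 ≤ K) :
    ∃ r : ℕ, 1 ≤ r ∧ 2 ^ r ≤ K ∧ Real.log K / 2 ≤ Real.log ((2 : ℝ) ^ r) := by
  refine ⟨Nat.log 2 K, Nat.log_pos (by norm_num) hK, Nat.pow_log_le_self 2 (by omega), ?_⟩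
  have h1 := Nat.lt_pow_succ_log_self (b := 2) (by norm_num) K
  have h2 : 1 ≤ Nat.log 2 K := Nat.log_pos (by norm_num) hK
  have h3 : (K : ℝ) ≤ 2 ^ (Nat.log 2 K + 1) := by exact_mod_cast h1.le
  have h4 := Real.log_le_log (by exact_mod_cast (by omega : 0 < K)) h3
  rw [Real.log_pow] at h4 ⊢
  have h5 : (1 : ℝ) ≤ Nat.log 2 K := by exact_mod_cast h2
  push_cast at h4
  nlinarith [Real.log_two_gt_d9]

/-- The lower bound from unknown labels, for the rows (`g = Prod.fst`) or the columns
(`g = Prod.snd`) of the array. -/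
lemma minimaxRisk_ge_labels {n m k l N r : ℕ} (hn : 0 < n) (hm : 0 < m) (hr : 1 ≤ r)
    (hrN : 2 ^ r ≤ N) {ι : Type*} [Fintype ι] [DecidableEq ι] {g : Fin n × Fin m → ι}
    {h : Fin n × Fin m → Fin r → Bool} (hg : ∀ i, #{p | g p = i} = N)
    (hh : ∀ i b, (N : ℝ) / (2 * 2 ^ r) ≤ #{p | g p = i ∧ h p = b})
    (hcard : Fintype.card ι * N = n * m)
    (hmem : ∀ z : ι → Fin r → Bool,
      ∃ (Q : Fin k → Fin l → ℝ) (z₁ : Fin n → Fin k) (z₂ : Fin m → Fin l),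
      (∀ a b, Q a b ^ 2 = 1) ∧
        ∀ i j, walsh (z (g (i, j))) (h (i, j)) = Q (z₁ i) (z₂ j)) :
    ENNReal.ofReal (Real.log ((2 : ℝ) ^ r) / N / 512) ≤ minimaxRisk n m k l := by
  have h2r : (1 : ℝ) ≤ 2 ^ r := one_le_pow₀ (by norm_num)
  have hrN' : (2 : ℝ) ^ r ≤ N := by exact_mod_cast hrN
  have hN : (0 : ℝ) < N := by linarith
  have hlog0 : 0 ≤ Real.log ((2 : ℝ) ^ r) := Real.log_nonneg h2r
  have hlog : Real.log ((2 : ℝ) ^ r) ≤ N :=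
    (Real.log_le_sub_one_of_pos (by positivity)).trans (by linarith)
  have hK : Fintype.card (Fin r → Bool) = 2 ^ r := by simp
  have hcard' : (Fintype.card ι : ℝ) * N = n * m := by exact_mod_cast hcard
  have hn' : (0 : ℝ) < n := by exact_mod_cast hn
  have hm' : (0 : ℝ) < m := by exact_mod_cast hm
  have key := minimaxRisk_ge (k := k) (l := l) (κ := Fin r → Bool) (g := g)
    (s := fun a p => walsh a (h p)) (x := Real.log ((2 : ℝ) ^ r) / N / 32) (D := N) hn hm
    (by rw [hK]; exact (pow_le_pow_right₀ (by norm_num) hr : 2 ^ 1 ≤ 2 ^ r))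
    (fun a p => walsh_sq _ _) (by positivity)
    (by
      have : Real.log ((2 : ℝ) ^ r) / N ≤ 1 := (div_le_one hN).mpr hlog
      linarith)
    (fun i => by
      rw [hg, hK]
      push_cast
      refine le_of_eq ?_
      field_simp)
    hN.le
    -- Each value of `h` occurs at least `N / (2 * 2^r)` times in a group, and the squared Walsh
    -- distance is `2 * 2^r`, so the separation is at least `N`.
    (fun i a b hab => by
      rw [← Finset.sum_fiberwise _ h]
      have e : ∀ c, ∑ p ∈ univ.filter (fun p => g p = i) with h p = c,
          (walsh a (h p) - walsh b (h p)) ^ 2 =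
          #{p | g p = i ∧ h p = c} * (walsh a c - walsh b c) ^ 2 := by
        intro c
        rw [Finset.filter_filter, ← nsmul_eq_mul, ← Finset.sum_const]
        refine Finset.sum_congr rfl fun p hp => ?_
        rw [(Finset.mem_filter.mp hp).2.2]
      simp_rw [e]
      calc (N : ℝ) = ∑ c, N / (2 * 2 ^ r) * (walsh a c - walsh b c) ^ 2 := by
            rw [← Finset.mul_sum, sum_walsh_sub_sq hab]; field_simp
        _ ≤ _ := Finset.sum_le_sum fun c _ =>
            mul_le_mul_of_nonneg_right (hh i c) (sq_nonneg _))
    hmem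
  refine le_trans (ENNReal.ofReal_le_ofReal (le_of_eq ?_)) key
  rw [← hcard']
  have : (0 : ℝ) < Fintype.card ι := by
    by_contra hc
    have : (Fintype.card ι : ℝ) = 0 := le_antisymm (not_lt.mp hc) (Nat.cast_nonneg _)
    rw [this, zero_mul] at hcard'
    have : (0 : ℝ) < n * m := by positivity
    linarith
  field_simp
  norm_num

lemma exists_embedding {r k : ℕ} (h : 2 ^ r ≤ k) :
    ∃ (e : (Fin r → Bool) → Fin k) (f : Fin k → Fin r → Bool), ∀ a, f (e a) = a := by
  obtain ⟨e⟩ := Function.Embedding.nonempty_of_card_le (α := Fin r → Bool) (β := Fin k)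
    (by simpa using h)
  exact ⟨e, Function.invFun e, Function.leftInverse_invFun e.injective⟩

/-- Columns are split into `2^r` fixed balanced clusters, and the unknown label of a row selects a
Walsh function of the cluster. Row labels must fit into `k` and clusters into `l`, which is why both
bounds on `2^r` are needed. -/
lemma minimaxRisk_ge_rows {n m k l r : ℕ} (hn : 0 < n) (hm : 0 < m) (hr : 1 ≤ r)
    (hk : 2 ^ r ≤ k) (hl : 2 ^ r ≤ l) (hlm : l ≤ m) :
    ENNReal.ofReal (Real.log ((2 : ℝ) ^ r) / m / 512) ≤ minimaxRisk n m k l := by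
  obtain ⟨e₁, f₁, hf₁⟩ := exists_embedding hk
  obtain ⟨e₂, f₂, hf₂⟩ := exists_embedding hl
  obtain ⟨c, hc⟩ := exists_balanced (κ := Fin r → Bool) (n := m) (by simp) (by simp; omega)
  refine minimaxRisk_ge_labels (g := Prod.fst) (h := fun p => c p.2) hn hm hr (hl.trans hlm)
    (fun i => ?_) (fun i b => ?_) (by simp) fun z => ⟨fun a b => walsh (f₁ a) (f₂ b),
      fun i => e₁ (z i), fun j => e₂ (c j), fun _ _ => walsh_sq _ _, fun i j => by simp [hf₁, hf₂]⟩
  · have : univ.filter (fun p : Fin n × Fin m => p.1 = i) = {i} ×ˢ univ := by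
      ext p; simp only [mem_filter, mem_univ, true_and, mem_product, mem_singleton, and_true]
    rw [this, Finset.card_product]; simp
  · have : univ.filter (fun p : Fin n × Fin m => p.1 = i ∧ c p.2 = b) =
        {i} ×ˢ univ.filter (fun j => c j = b) := by
      ext p; simp only [mem_filter, mem_univ, true_and, mem_product, mem_singleton]
    rw [this, Finset.card_product, Finset.card_singleton, one_mul]
    simpa using (hc b).1

lemma minimaxRisk_ge_columns {n m k l r : ℕ} (hn : 0 < n) (hm : 0 < m) (hr : 1 ≤ r)
    (hk : 2 ^ r ≤ k) (hl : 2 ^ r ≤ l) (hkn : k ≤ n) :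
    ENNReal.ofReal (Real.log ((2 : ℝ) ^ r) / n / 512) ≤ minimaxRisk n m k l := by
  obtain ⟨e₁, f₁, hf₁⟩ := exists_embedding hk
  obtain ⟨e₂, f₂, hf₂⟩ := exists_embedding hl
  obtain ⟨c, hc⟩ := exists_balanced (κ := Fin r → Bool) (n := n) (by simp) (by simp; omega)
  refine minimaxRisk_ge_labels (g := Prod.snd) (h := fun p => c p.1) hn hm hr (hk.trans hkn)
    (fun i => ?_) (fun i b => ?_) (by simp [mul_comm]) fun z =>
      ⟨fun a b => walsh (f₂ b) (f₁ a), fun i => e₁ (c i), fun j => e₂ (z j),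
        fun _ _ => walsh_sq _ _, fun i j => by simp [hf₁, hf₂]⟩
  · have : univ.filter (fun p : Fin n × Fin m => p.2 = i) = univ ×ˢ {i} := by
      ext p; simp only [mem_filter, mem_univ, true_and, mem_product, mem_singleton]
    rw [this, Finset.card_product]; simp
  · have : univ.filter (fun p : Fin n × Fin m => p.2 = i ∧ c p.1 = b) =
        univ.filter (fun j => c j = b) ×ˢ {i} := by
      ext p; simp only [mem_filter, mem_univ, true_and, mem_product, mem_singleton, and_comm]
    rw [this, Finset.card_product, Finset.card_singleton, mul_one]
    simpa using (hc b).1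

/-- The lower bound from the unknown labels of rows and columns. -/
lemma minimaxRisk_ge_log {n m k l : ℕ} (hk : 1 ≤ k) (hkn : k ≤ n) (hl : 1 ≤ l) (hlm : l ≤ m) :
    ENNReal.ofReal (Real.log (min k l : ℕ) / m / 1024) ≤ minimaxRisk n m k l ∧
      ENNReal.ofReal (Real.log (min k l : ℕ) / n / 1024) ≤ minimaxRisk n m k l := by
  by_cases h2 : 2 ≤ min k l
  · obtain ⟨r, hr, hrK, hlog⟩ := exists_two_pow h2
    have hk2 : 2 ^ r ≤ k := hrK.trans (min_le_left _ _)
    have hl2 : 2 ^ r ≤ l := hrK.trans (min_le_right _ _)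
    have hcomp : ∀ N : ℕ, Real.log (min k l : ℕ) / N / 1024 ≤
        Real.log ((2 : ℝ) ^ r) / N / 512 := by
      intro N
      have := div_le_div_of_nonneg_right hlog (Nat.cast_nonneg (α := ℝ) N)
      have e : Real.log (min k l : ℕ) / 2 / N = Real.log (min k l : ℕ) / N / 2 := by ring
      linarith
    exact ⟨(ENNReal.ofReal_le_ofReal (hcomp m)).trans
        (minimaxRisk_ge_rows (by omega) (by omega) hr hk2 hl2 hlm),
      (ENNReal.ofReal_le_ofReal (hcomp n)).trans
        (minimaxRisk_ge_columns (by omega) (by omega) hr hk2 hl2 hkn)⟩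
  · have : min k l = 1 := by omega
    simp [this]

/-! ### Combining the bounds -/

lemma minimaxRisk_ge_rate {n m k l : ℕ} (hk : 1 ≤ k) (hkn : k ≤ n) (hl : 1 ≤ l) (hlm : l ≤ m)
    {C₀ : ℝ} (hC₀ : 1 ≤ C₀) (h1 : Real.log l ≤ C₀ * Real.log k)
    (h2 : Real.log k ≤ C₀ * Real.log l) :
    ENNReal.ofReal ((12288 * C₀)⁻¹ * rate n m k l) ≤ minimaxRisk n m k l := by
  have hk0 : 0 ≤ Real.log k := Real.log_natCast_nonneg k
  have hl0 : 0 ≤ Real.log l := Real.log_natCast_nonneg l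
  have hmin : Real.log k ≤ C₀ * Real.log (min k l : ℕ) ∧
      Real.log l ≤ C₀ * Real.log (min k l : ℕ) := by
    rcases le_total k l with h | h
    · rw [min_eq_left h]; exact ⟨by nlinarith, h1⟩
    · rw [min_eq_right h]; exact ⟨h2, by nlinarith⟩
  obtain ⟨hrow, hcol⟩ := minimaxRisk_ge_log hk hkn hl hlm
  have hblk := minimaxRisk_ge_blocks hk hkn hl hlm
  set M := Real.log (min k l : ℕ) with hM
  have hM0 : 0 ≤ M := Real.log_natCast_nonneg _
  have hn : (0 : ℝ) < n := by exact_mod_cast (by omega : 0 < n)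
  have hm : (0 : ℝ) < m := by exact_mod_cast (by omega : 0 < m)
  set a := ((k : ℝ) * l) / (n * m) with ha
  have ha0 : 0 ≤ a := by positivity
  have hb : Real.log k / m ≤ C₀ * (M / m) := by
    rw [← mul_div_assoc]; exact div_le_div_of_nonneg_right hmin.1 hm.le
  have hc : Real.log l / n ≤ C₀ * (M / n) := by
    rw [← mul_div_assoc]; exact div_le_div_of_nonneg_right hmin.2 hn.le
  have hrate : (12288 * C₀)⁻¹ * rate n m k l ≤
      max (a / 4096) (max (M / m / 1024) (M / n / 1024)) := by
    -- Each of the three terms of the rate is at most `4096 * C₀ * W`, and `12288 = 3 * 4096`.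
    set W := max (a / 4096) (max (M / m / 1024) (M / n / 1024)) with hW
    have w1 : a / 4096 ≤ W := le_max_left _ _
    have w2 : M / m / 1024 ≤ W := (le_max_left _ _).trans (le_max_right _ _)
    have w3 : M / n / 1024 ≤ W := (le_max_right _ _).trans (le_max_right _ _)
    have hW0 : 0 ≤ W := le_trans (by positivity) w1
    rw [inv_mul_le_iff₀ (by positivity), rate, ← ha]
    have : C₀ * (M / m) ≤ C₀ * (1024 * W) := by gcongr; linarith
    have : C₀ * (M / n) ≤ C₀ * (1024 * W) := by gcongr; linarith
    have : 4096 * W ≤ C₀ * (4096 * W) := le_mul_of_one_le_left (by positivity) hC₀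
    nlinarith [mul_nonneg (by linarith : 0 ≤ C₀) hW0]
  refine (ENNReal.ofReal_le_ofReal hrate).trans ?_
  rw [ENNReal.ofReal_max, ENNReal.ofReal_max]
  exact max_le hblk (max_le hrow hcol)

end Biclustering

/-- `C₀` is the constant in the assumption `log k ≍ log l`; the constant `C` of the conclusion
depends on `C₀` only. -/
theorem theorem3p2 :
    ∀ C₀ : ℝ, 0 < C₀ → ∃ C : ℝ, 0 < C ∧
      ∀ n m k l : ℕ, 1 ≤ k → k ≤ n → 1 ≤ l → l ≤ m →
        C₀⁻¹ * Real.log l ≤ Real.log k → Real.log k ≤ C₀ * Real.log l →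
          ENNReal.ofReal (C⁻¹ * Biclustering.rate n m k l) ≤ Biclustering.minimaxRisk n m k l ∧
          Biclustering.minimaxRisk n m k l ≤ ENNReal.ofReal (C * Biclustering.rate n m k l) := by
  intro C₀ hC₀
  -- Enlarging `C₀` to at least 1 weakens the assumption and lets one constant serve both
  -- directions.
  have h1 : 1 ≤ max C₀ 1 := le_max_right _ _
  refine ⟨12288 * max C₀ 1, by positivity, fun n m k l hk hkn hl hlm hlk hkl => ⟨?_, ?_⟩⟩
  · have hk0 : 0 ≤ Real.log k := Real.log_natCast_nonneg k
    have hl0 : 0 ≤ Real.log l := Real.log_natCast_nonneg l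
    rw [inv_mul_le_iff₀ hC₀] at hlk
    exact Biclustering.minimaxRisk_ge_rate hk hkn hl hlm h1
      (hlk.trans (mul_le_mul_of_nonneg_right (le_max_left _ _) hk0))
      (hkl.trans (mul_le_mul_of_nonneg_right (le_max_left _ _) hl0))
  · refine (Biclustering.minimaxRisk_le hk hkn hl hlm).trans (ENNReal.ofReal_le_ofReal ?_)
    have hrate : 0 ≤ Biclustering.rate n m k l := by
      have := Real.log_natCast_nonneg k
      have := Real.log_natCast_nonneg l
      unfold Biclustering.rate
      positivity
    exact mul_le_mul_of_nonneg_right (by linarith) hrate
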